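/- Let $L_2$ be the two-sorted language of second-order arithmetic, with number variables, set variables, the symbols $0,1,+,\cdot,\le$ and equality on numbers, and membership $\in$ of numbers in sets. A formula is $\Delta^0_0$ if all its quantifiers are bounded number quantifiers ($\forall x\le t$, $\exists x\le t$), $\Sigma^0_1$ if it is of the form $\exists\bar x\,\theta$ and $\Sigma^0_2$ if it is of the form $\exists\bar x\,\forall\bar y\,\theta$, with $\theta$ a $\Delta^0_0$ formula and $\bar x,\bar y$ blocks of number variables; free number and set variables are allowed as parameters. For $k=1,2$, $\Sigma^0_k$-$\mathsf{IND}$ is the scheme of all sentences $$\forall \bar Y\,\forall\bar y\,\big[\varphi(0)\land\forall x\,(\varphi(x)\Rightarrow\varphi(x+1))\Rightarrow\forall x\,\varphi(x)\big],\qquad \varphi(x)=\varphi(x,\bar Y,\bar y)\ \text{a } \Sigma^0_k \text{ formula}.$$ The theory $\mathsf{RCA}_0$ consists of the axioms saying that the numbers form the non-negative part of a discretely ordered ring, the scheme $\Sigma^0_1$-$\mathsf{IND}$, and $\Delta^0_1$-comprehension $$\forall \bar Y\,\forall\bar y\,\big[\forall x\,(\varphi(x)\Leftrightarrow\neg\psi(x))\Rightarrow\exists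 X\,\forall x\,(x\in X\Leftrightarrow\varphi(x))\big],\qquad \varphi(x)=\varphi(x,\bar Y,\bar y),\ \psi(x)=\psi(x,\bar Y,\bar y)\ \text{$\Sigma^0_1$ formulas}.$$ Ordered Ramsey's Theorem is the $L_2$-sentence stating: for every finite partial order $(P,\preceq)$ and every colouring $C:[\mathbb N]^2\to P$ such that $C(i,j)\succeq C(i,k)$ for all $i<j<k$, there is an infinite set $I\subseteq\mathbb N$ such that $C(i,j)=C(i',j')$ for all $i<j$ and $i'<j'$ in $I$. (Here finite means bounded, infinite means unbounded, and the relation $\preceq$ and the function $C$ are coded as sets of numbers through the pairing $\langle i,j\rangle=(i+j)^2+i$.) Over $\mathsf{RCA}_0$, Ordered Ramsey's Theorem implies $\Sigma^0_2$-$\mathsf{IND}$; that is, every sentence of $\Sigma^0_2$-$\mathsf{IND}$ is a logical consequence of $\mathsf{RCA}_0$ together with Ordered Ramsey's Theorem: it holds in every $L_2$-structure that is a model of $\mathsf{RCA}_0$ and of Ordered Ramsey's Theorem. -/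

import Mathlib

universe u

namespace SecondOrderArithmetic

/-! ### Syntax of the two-sorted language `L₂`

Variables are de Bruijn indices: a formula in `Formula m n` has its free set variables in `Fin m`
and its free number variables in `Fin n`; a quantifier binds the variable of index `0`. -/

/-- Number terms with free variables in `Fin n`. -/
inductive Term (n : ℕ) : Type
  | var (i : Fin n) : Term n
  | zero : Term n
  | one : Term n
  | add (s t : Term n) : Term n
  | mul (s t : Term n) : Term n

instance (n : ℕ) : Zero (Term n) := ⟨Term.zero⟩

instance (n : ℕ) : One (Term n) := ⟨Term.one⟩

instance (n : ℕ) : Add (Term n) := ⟨Term.add⟩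

instance (n : ℕ) : Mul (Term n) := ⟨Term.mul⟩

/-- Formulas of `L₂` with free set variables in `Fin m` and free number variables in `Fin n`. -/
inductive Formula : ℕ → ℕ → Type
  | eq {m n : ℕ} (s t : Term n) : Formula m n
  | le {m n : ℕ} (s t : Term n) : Formula m n
  | mem {m n : ℕ} (t : Term n) (X : Fin m) : Formula m n
  | not {m n : ℕ} (φ : Formula m n) : Formula m n
  | and {m n : ℕ} (φ ψ : Formula m n) : Formula m n
  | or {m n : ℕ} (φ ψ : Formula m n) : Formula m n
  | imp {m n : ℕ} (φ ψ : Formula m n) : Formula m n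
  | all {m n : ℕ} (φ : Formula m (n + 1)) : Formula m n
  | ex {m n : ℕ} (φ : Formula m (n + 1)) : Formula m n
  | allSet {m n : ℕ} (φ : Formula (m + 1) n) : Formula m n
  | exSet {m n : ℕ} (φ : Formula (m + 1) n) : Formula m n

/-- Sentences of `L₂`. -/
abbrev Sentence : Type := Formula 0 0

local prefix:max "♯" => Term.var
local infix:60 " ≐ " => Formula.eq
local infix:60 " ≼ " => Formula.le
local infix:60 " ε " => Formula.mem
local infixr:50 " ⋏ " => Formula.and
local infixr:40 " ⟹ " => Formula.imp

/-- Simultaneous substitution of number terms for number variables. -/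
def Term.subst {n n' : ℕ} (σ : Fin n → Term n') : Term n → Term n'
  | .var i => σ i
  | .zero => .zero
  | .one => .one
  | .add s t => .add (s.subst σ) (t.subst σ)
  | .mul s t => .mul (s.subst σ) (t.subst σ)

/-- Weakening by one fresh number variable, of index `0`. -/
def Term.lift {n : ℕ} (t : Term n) : Term (n + 1) := t.subst fun i => ♯i.succ

/-- Simultaneous capture-avoiding substitution of terms for number variables and renaming of set
variables. -/
def Formula.subst {m n : ℕ} : Formula m n → {m' n' : ℕ} → (Fin m → Fin m') → (Fin n → Term n') →
    Formula m' n'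
  | .eq s t, _, _, _, σ => .eq (s.subst σ) (t.subst σ)
  | .le s t, _, _, _, σ => .le (s.subst σ) (t.subst σ)
  | .mem t X, _, _, ρ, σ => .mem (t.subst σ) (ρ X)
  | .not φ, _, _, ρ, σ => .not (φ.subst ρ σ)
  | .and φ ψ, _, _, ρ, σ => .and (φ.subst ρ σ) (ψ.subst ρ σ)
  | .or φ ψ, _, _, ρ, σ => .or (φ.subst ρ σ) (ψ.subst ρ σ)
  | .imp φ ψ, _, _, ρ, σ => .imp (φ.subst ρ σ) (ψ.subst ρ σ)
  | .all φ, _, _, ρ, σ => .all (φ.subst ρ (Matrix.vecCons ♯0 fun i => (σ i).lift))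
  | .ex φ, _, _, ρ, σ => .ex (φ.subst ρ (Matrix.vecCons ♯0 fun i => (σ i).lift))
  | .allSet φ, _, _, ρ, σ => .allSet (φ.subst (Matrix.vecCons 0 fun i => (ρ i).succ) σ)
  | .exSet φ, _, _, ρ, σ => .exSet (φ.subst (Matrix.vecCons 0 fun i => (ρ i).succ) σ)

namespace Formula

/-- `s < t`. -/
def lt {m n : ℕ} (s t : Term n) : Formula m n := s ≼ t ⋏ not (s ≐ t)

/-- `φ ⇔ ψ`. -/
def iff {m n : ℕ} (φ ψ : Formula m n) : Formula m n := (φ ⟹ ψ) ⋏ (ψ ⟹ φ)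

/-- A block of `k` existential number quantifiers. -/
def exBlock {m n : ℕ} : (k : ℕ) → Formula m (n + k) → Formula m n
  | 0, φ => φ
  | k + 1, φ => exBlock k (ex φ)

/-- A block of `k` universal number quantifiers. -/
def allBlock {m n : ℕ} : (k : ℕ) → Formula m (n + k) → Formula m n
  | 0, φ => φ
  | k + 1, φ => allBlock k (all φ)

/-- Universal closure with respect to all number variables. -/
def closeNum {m : ℕ} : {n : ℕ} → Formula m n → Formula m 0
  | 0, φ => φ
  | _ + 1, φ => closeNum (all φ)

/-- Universal closure with respect to all set variables. -/
def closeSet : {m : ℕ} → Formula m 0 → Sentence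
  | 0, φ => φ
  | _ + 1, φ => closeSet (allSet φ)

/-- Universal closure. -/
def close {m n : ℕ} (φ : Formula m n) : Sentence := closeSet (closeNum φ)

/-- `Δ⁰₀` formulas: all quantifiers are bounded number quantifiers `∀ x ≤ t` and `∃ x ≤ t`, where
the variable `x` does not occur in the term `t`. -/
inductive IsDelta0 : {m n : ℕ} → Formula m n → Prop
  | eq {m n : ℕ} (s t : Term n) : IsDelta0 (eq (m := m) s t)
  | le {m n : ℕ} (s t : Term n) : IsDelta0 (le (m := m) s t)
  | mem {m n : ℕ} (t : Term n) (X : Fin m) : IsDelta0 (mem t X)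
  | not {m n : ℕ} {φ : Formula m n} : IsDelta0 φ → IsDelta0 (not φ)
  | and {m n : ℕ} {φ ψ : Formula m n} : IsDelta0 φ → IsDelta0 ψ → IsDelta0 (and φ ψ)
  | or {m n : ℕ} {φ ψ : Formula m n} : IsDelta0 φ → IsDelta0 ψ → IsDelta0 (or φ ψ)
  | imp {m n : ℕ} {φ ψ : Formula m n} : IsDelta0 φ → IsDelta0 ψ → IsDelta0 (imp φ ψ)
  | ball {m n : ℕ} (t : Term n) {φ : Formula m (n + 1)} :
      IsDelta0 φ → IsDelta0 (all (♯0 ≼ t.lift ⟹ φ))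
  | bex {m n : ℕ} (t : Term n) {φ : Formula m (n + 1)} :
      IsDelta0 φ → IsDelta0 (ex (♯0 ≼ t.lift ⋏ φ))

/-- `QForm true k φ`: `φ` is `∃ x̄₁ ∀ x̄₂ … ψ` with `k` alternating blocks of number quantifiers,
the first existential, and `ψ` a `Δ⁰₀` formula; `QForm false k φ`: the same, starting with a
universal block. -/
def QForm : Bool → (k : ℕ) → {m n : ℕ} → Formula m n → Prop
  | _, 0, _, _, φ => IsDelta0 φ
  | true, k + 1, m, n, φ => ∃ (j : ℕ) (ψ : Formula m (n + j)), QForm false k ψ ∧ φ = exBlock j ψ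
  | false, k + 1, m, n, φ => ∃ (j : ℕ) (ψ : Formula m (n + j)), QForm true k ψ ∧ φ = allBlock j ψ

/-- `Σ⁰ₖ` formulas. -/
def IsSigma (k : ℕ) {m n : ℕ} (φ : Formula m n) : Prop := QForm true k φ

end Formula

open Formula

/-! ### Theories -/

/-- The axioms saying that the number sort is the non-negative part of a discretely ordered
(commutative) ring. -/
def basicAxioms : Set Sentence :=
  { close (m := 0) (n := 3) ((♯0 + ♯1) + ♯2 ≐ ♯0 + (♯1 + ♯2)),
    close (m := 0) (n := 2) (♯0 + ♯1 ≐ ♯1 + ♯0),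
    close (m := 0) (n := 1) (♯0 + 0 ≐ ♯0),
    close (m := 0) (n := 3) ((♯0 * ♯1) * ♯2 ≐ ♯0 * (♯1 * ♯2)),
    close (m := 0) (n := 2) (♯0 * ♯1 ≐ ♯1 * ♯0),
    close (m := 0) (n := 1) (♯0 * 1 ≐ ♯0),
    close (m := 0) (n := 1) (♯0 * 0 ≐ 0),
    close (m := 0) (n := 3) (♯0 * (♯1 + ♯2) ≐ ♯0 * ♯1 + ♯0 * ♯2),
    close (m := 0) (n := 1) (♯0 ≼ ♯0),
    close (m := 0) (n := 2) (♯0 ≼ ♯1 ⋏ ♯1 ≼ ♯0 ⟹ ♯0 ≐ ♯1),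
    close (m := 0) (n := 3) (♯0 ≼ ♯1 ⋏ ♯1 ≼ ♯2 ⟹ ♯0 ≼ ♯2),
    close (m := 0) (n := 2) (or (♯0 ≼ ♯1) (♯1 ≼ ♯0)),
    close (m := 0) (n := 3) (lt ♯0 ♯1 ⟹ lt (♯0 + ♯2) (♯1 + ♯2)),
    close (m := 0) (n := 3) (lt 0 ♯2 ⋏ lt ♯0 ♯1 ⟹ lt (♯0 * ♯2) (♯1 * ♯2)),
    close (m := 0) (n := 2) (♯0 ≼ ♯1 ⟹ ex (♯1 + ♯0 ≐ ♯2)),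
    close (m := 0) (n := 1) (0 ≼ ♯0),
    close (m := 0) (n := 0) (lt 0 1),
    close (m := 0) (n := 1) (lt 0 ♯0 ⟹ 1 ≼ ♯0) }

/-- The instance `∀ Ȳ ∀ ȳ [φ(0) ∧ ∀ x (φ(x) ⇒ φ(x + 1)) ⇒ ∀ x φ(x)]` of induction; the induction
variable has index `0` in `φ`. -/
def inductionAxiom {m n : ℕ} (φ : Formula m (n + 1)) : Sentence :=
  close ((φ.subst id (Matrix.vecCons 0 Term.var) ⋏
    all (φ ⟹ φ.subst id (Matrix.vecCons (♯0 + 1) fun i => ♯i.succ))) ⟹ all φ)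

/-- The scheme `Σ⁰ₖ-IND`. -/
def SigmaInduction (k : ℕ) : Set Sentence :=
  {χ | ∃ (m n : ℕ) (φ : Formula m (n + 1)), IsSigma k φ ∧ χ = inductionAxiom φ}

/-- The instance `∀ Ȳ ∀ ȳ [∀ x (φ(x) ⇔ ¬ψ(x)) ⇒ ∃ X ∀ x (x ∈ X ⇔ φ(x))]` of comprehension, where
`X` does not occur in `φ`. -/
def deltaComprehensionAxiom {m n : ℕ} (φ ψ : Formula m (n + 1)) : Sentence :=
  close (all (iff φ (not ψ)) ⟹ exSet (all (iff (♯0 ε 0) (φ.subst Fin.succ Term.var))))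

/-- The scheme of `Δ⁰₁`-comprehension. -/
def DeltaComprehension : Set Sentence :=
  {χ | ∃ (m n : ℕ) (φ ψ : Formula m (n + 1)), IsSigma 1 φ ∧ IsSigma 1 ψ ∧
    χ = deltaComprehensionAxiom φ ψ}

/-- The theory `RCA₀`. -/
def RCA0 : Set Sentence := basicAxioms ∪ DeltaComprehension ∪ SigmaInduction 1

/-! ### Ordered Ramsey's Theorem as a sentence of `L₂` -/

/-- The usual pairing `⟨s, t⟩ = (s + t)² + s` of second-order arithmetic. -/
def Term.pair {n : ℕ} (s t : Term n) : Term n := (s + t) * (s + t) + s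

/-- `P` is finite, that is, bounded. -/
def isFinite {m : ℕ} (P : Fin m) : Formula m 0 := ex (all (♯0 ε P ⟹ lt ♯0 ♯1))

/-- `R` is (the set of codes of pairs of) a partial order on the set `P`. -/
def isPartialOrder {m : ℕ} (P R : Fin m) : Formula m 0 :=
  closeNum (n := 1) (♯0 ε R ⟹ ex (ex (♯0 ε P ⋏ ♯1 ε P ⋏ ♯2 ≐ Term.pair ♯0 ♯1))) ⋏
  closeNum (n := 1) (♯0 ε P ⟹ Term.pair ♯0 ♯0 ε R) ⋏
  closeNum (n := 2) (Term.pair ♯0 ♯1 ε R ⋏ Term.pair ♯1 ♯0 ε R ⟹ ♯0 ≐ ♯1) ⋏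
  closeNum (n := 3) (Term.pair ♯0 ♯1 ε R ⋏ Term.pair ♯1 ♯2 ε R ⟹ Term.pair ♯0 ♯2 ε R)

/-- `C(i, j) = p`, for the colouring coded by the set `C` of codes `⟨⟨i, j⟩, p⟩`. -/
def hasColour {m n : ℕ} (C : Fin m) (i j p : Term n) : Formula m n :=
  Term.pair (Term.pair i j) p ε C

/-- `C` is a function from `[ℕ]²` to `P`; an unordered pair `{i, j}` with `i < j` is represented by
`⟨i, j⟩`. -/
def isColouring {m : ℕ} (P C : Fin m) : Formula m 0 :=
  closeNum (n := 1) (♯0 ε C ⟹ ex (ex (ex (lt ♯0 ♯1 ⋏ ♯2 ε P ⋏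
    ♯3 ≐ Term.pair (Term.pair ♯0 ♯1) ♯2)))) ⋏
  closeNum (n := 2) (lt ♯0 ♯1 ⟹ ex (hasColour C ♯1 ♯2 ♯0)) ⋏
  closeNum (n := 4) (hasColour C ♯0 ♯1 ♯2 ⋏ hasColour C ♯0 ♯1 ♯3 ⟹ ♯2 ≐ ♯3)

/-- `C(i, j) ⪰ C(i, k)` for all `i < j < k`. The variables `0, …, 4` are `i, j, k`, `C(i, j)`,
`C(i, k)`. -/
def isOrdered {m : ℕ} (R C : Fin m) : Formula m 0 :=
  closeNum (n := 5) (lt ♯0 ♯1 ⋏ lt ♯1 ♯2 ⋏ hasColour C ♯0 ♯1 ♯3 ⋏ hasColour C ♯0 ♯2 ♯4 ⟹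
    Term.pair ♯4 ♯3 ε R)

/-- `I` is infinite, that is, unbounded. -/
def isInfinite {m : ℕ} (I : Fin m) : Formula m 0 := all (ex (♯1 ≼ ♯0 ⋏ ♯0 ε I))

/-- `C(i, j) = C(i', j')` for all `i < j` and `i' < j'` in `I`. The variables `0, …, 5` are
`i, j, i', j'`, `C(i, j)`, `C(i', j')`. -/
def isHomogeneous {m : ℕ} (C I : Fin m) : Formula m 0 :=
  closeNum (n := 6) (♯0 ε I ⋏ ♯1 ε I ⋏ lt ♯0 ♯1 ⋏ ♯2 ε I ⋏ ♯3 ε I ⋏ lt ♯2 ♯3 ⋏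
    hasColour C ♯0 ♯1 ♯4 ⋏ hasColour C ♯2 ♯3 ♯5 ⟹ ♯4 ≐ ♯5)

/-- Ordered Ramsey's Theorem for pairs. In the hypotheses the set variables `0, 1, 2` are `P`, `R`
(the order on `P`), `C`; the conclusion has the additional variable `I`, of index `0`. -/
def orderedRamsey : Sentence :=
  closeSet (m := 3)
    (isFinite 0 ⋏ isPartialOrder 0 1 ⋏ isColouring 0 2 ⋏ isOrdered 1 2 ⟹
      exSet (isInfinite 0 ⋏ isHomogeneous 3 0))

/-! ### Semantics -/

/-- An `L₂`-structure: a number sort with its operations, and a nonempty family of subsets of it as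
the set sort. Membership and equality of numbers are the true ones. -/
structure L2Structure where
  /-- The number sort. -/
  Num : Type u
  zero : Num
  one : Num
  add : Num → Num → Num
  mul : Num → Num → Num
  le : Num → Num → Prop
  /-- The range of the set variables. -/
  sets : Set (Set Num)
  sets_nonempty : sets.Nonempty

/-- The value of a term. -/
def Term.val (M : L2Structure.{u}) {n : ℕ} (e : Fin n → M.Num) : Term n → M.Num
  | .var i => e i
  | .zero => M.zero
  | .one => M.one
  | .add s t => M.add (s.val M e) (t.val M e)
  | .mul s t => M.mul (s.val M e) (t.val M e)

/-- Satisfaction; set quantifiers range over `M.sets`. -/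
def Formula.Sat (M : L2Structure.{u}) : {m n : ℕ} → Formula m n →
    (Fin m → Set M.Num) → (Fin n → M.Num) → Prop
  | _, _, .eq s t, _, e => s.val M e = t.val M e
  | _, _, .le s t, _, e => M.le (s.val M e) (t.val M e)
  | _, _, .mem t X, E, e => t.val M e ∈ E X
  | _, _, .not φ, E, e => ¬ φ.Sat M E e
  | _, _, .and φ ψ, E, e => φ.Sat M E e ∧ ψ.Sat M E e
  | _, _, .or φ ψ, E, e => φ.Sat M E e ∨ ψ.Sat M E e
  | _, _, .imp φ ψ, E, e => φ.Sat M E e → ψ.Sat M E e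
  | _, _, .all φ, E, e => ∀ x : M.Num, φ.Sat M E (Matrix.vecCons x e)
  | _, _, .ex φ, E, e => ∃ x : M.Num, φ.Sat M E (Matrix.vecCons x e)
  | _, _, .allSet φ, E, e => ∀ X ∈ M.sets, φ.Sat M (Matrix.vecCons X E) e
  | _, _, .exSet φ, E, e => ∃ X ∈ M.sets, φ.Sat M (Matrix.vecCons X E) e

/-- `M ⊨ φ` for a sentence `φ`. -/
def L2Structure.Models (M : L2Structure.{u}) (φ : Sentence) : Prop := φ.Sat M ![] ![]

/-- `φ` is a logical consequence of `T`: every model of `T` is a model of `φ`. -/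
def Entails (T : Set Sentence) (φ : Sentence) : Prop :=
  ∀ M : L2Structure.{u}, (∀ ψ ∈ T, M.Models ψ) → M.Models φ

end SecondOrderArithmetic

/-! Let `φ(x)` be `∃x̄ ∀ȳ θ` with `θ` a `Δ⁰₀` formula, and approximate it by the `Δ⁰₀` relation `T i
j x`, namely `∃x̄ ≤ i ∀ȳ ≤ j θ`, which is monotone in `i` and antitone in `j`. Then `φ(x)` holds iff
some `i` satisfies `T i j x` for all `j`. Left to right, bound the witnesses; right to left is a
collection principle that follows from `Σ⁰₁` induction (`sigma1_collection`,
`bexB_forall_of_forall_bexB`).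

Suppose `φ(0)` holds and `φ` is closed under successor, and fix `a`. Colour `{i, j}`, `i < j`, by
the greatest `x ≤ a` such that `x = 0` or `T i j x`. This colour exists by `exists_greatest`, the
colouring is a set by comprehension, and it is nonincreasing in `j`, so Ordered Ramsey's Theorem for
the order `{0, …, a}` gives an unbounded homogeneous set `I` of some colour `p`
(`exists_unbounded_greatest_eq`). Fix `i` in `I`: if `p ≠ 0`, then `T i j p` holds for unboundedly
many `j`, hence for all `j`, so `φ(p)`; if `p = 0`, then `φ(p)` is given. Were `p < a`, then `φ(p +
1)` would follow, so `T i j (p + 1)` would hold for all large `i` and all `j`, and pairs far out in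
`I` would have a colour above `p`. Hence `p = a` and `φ(a)` holds. -/

namespace SecondOrderArithmetic

open Formula

/-! ### Satisfaction, substitution and universal closures -/

theorem Term.val_subst (M : L2Structure.{u}) {n n' : ℕ} (σ : Fin n → Term n') (e : Fin n' → M.Num)
    (t : Term n) : (t.subst σ).val M e = t.val M fun i => (σ i).val M e := by
  induction t with
  | var i => rfl
  | zero => rfl
  | one => rfl
  | add s t hs ht => simp only [Term.subst, Term.val, hs, ht]
  | mul s t hs ht => simp only [Term.subst, Term.val, hs, ht]

theorem Term.val_lift (M : L2Structure.{u}) {n : ℕ} (t : Term n) (x : M.Num) (e : Fin n → M.Num) :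
    t.lift.val M (Matrix.vecCons x e) = t.val M e := by
  simp [Term.lift, Term.val_subst, Term.val]

theorem val_vecCons_lift (M : L2Structure.{u}) {n n' : ℕ} (σ : Fin n → Term n') (x : M.Num)
    (e : Fin n' → M.Num) :
    (fun i => (Matrix.vecCons (Term.var 0) (fun i => (σ i).lift) i : Term (n' + 1)).val M
      (Matrix.vecCons x e)) = Matrix.vecCons x fun i => (σ i).val M e := by
  funext i
  refine Fin.cases ?_ (fun i => ?_) i
  · rfl
  · simp [Term.val_lift]

theorem Formula.sat_subst (M : L2Structure.{u}) {m n : ℕ} (φ : Formula m n) :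
    ∀ {m' n' : ℕ} (ρ : Fin m → Fin m') (σ : Fin n → Term n') (E : Fin m' → Set M.Num)
      (e : Fin n' → M.Num),
      (φ.subst ρ σ).Sat M E e ↔ φ.Sat M (fun i => E (ρ i)) fun i => (σ i).val M e := by
  have hset : ∀ {k k' : ℕ} (ρ : Fin k → Fin k') (X : Set M.Num) (E : Fin k' → Set M.Num),
      (fun i => Matrix.vecCons X E (Matrix.vecCons 0 (fun i => (ρ i).succ) i)) =
        Matrix.vecCons X fun i => E (ρ i) := by
    intro k k' ρ X E
    funext i
    refine Fin.cases ?_ (fun i => ?_) i <;> simp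
  induction φ with
  | eq s t => intros; simp only [Formula.subst, Sat, Term.val_subst]
  | le s t => intros; simp only [Formula.subst, Sat, Term.val_subst]
  | mem t X => intros; simp only [Formula.subst, Sat, Term.val_subst]
  | not φ h => intros; simp only [Formula.subst, Sat, h]
  | and φ ψ h h' => intros; simp only [Formula.subst, Sat, h, h']
  | or φ ψ h h' => intros; simp only [Formula.subst, Sat, h, h']
  | imp φ ψ h h' => intros; simp only [Formula.subst, Sat, h, h']
  | all φ h => intros; simp only [Formula.subst, Sat, h, val_vecCons_lift]
  | ex φ h => intros; simp only [Formula.subst, Sat, h, val_vecCons_lift]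
  | allSet φ h => intros; simp only [Formula.subst, Sat, h, hset]
  | exSet φ h => intros; simp only [Formula.subst, Sat, h, hset]

theorem sat_closeNum (M : L2Structure.{u}) {m n : ℕ} (φ : Formula m n) (E : Fin m → Set M.Num) :
    (closeNum φ).Sat M E ![] ↔ ∀ e, φ.Sat M E e := by
  induction n with
  | zero =>
    refine ⟨fun h e => ?_, fun h => h _⟩
    rwa [Subsingleton.elim e ![]]
  | succ n ih =>
    refine (ih (all φ)).trans ⟨fun h e => ?_, fun h e x => h _⟩
    rw [← Matrix.cons_head_tail e]
    exact h _ _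

theorem models_closeSet (M : L2Structure.{u}) {m : ℕ} (φ : Formula m 0) :
    M.Models (closeSet φ) ↔ ∀ E : Fin m → Set M.Num, (∀ i, E i ∈ M.sets) → φ.Sat M E ![] := by
  induction m with
  | zero =>
    refine ⟨fun h E _ => ?_, fun h => h _ fun i => i.elim0⟩
    rwa [Subsingleton.elim E ![]]
  | succ m ih =>
    refine (ih (allSet φ)).trans ⟨fun h E hE => ?_, fun h E hE X hX => h _ fun i => ?_⟩
    · rw [← Matrix.cons_head_tail E]
      exact h _ (fun i => hE i.succ) _ (hE 0)
    · exact Fin.cases hX hE i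

theorem models_close (M : L2Structure.{u}) {m n : ℕ} (φ : Formula m n) :
    M.Models (close φ) ↔
      ∀ E : Fin m → Set M.Num, (∀ i, E i ∈ M.sets) → ∀ e, φ.Sat M E e := by
  simp only [close, models_closeSet, sat_closeNum]

theorem models_inductionAxiom (M : L2Structure.{u}) {m n : ℕ} (φ : Formula m (n + 1)) :
    M.Models (inductionAxiom φ) ↔
      ∀ E : Fin m → Set M.Num, (∀ i, E i ∈ M.sets) → ∀ e : Fin n → M.Num,
        φ.Sat M E (Matrix.vecCons M.zero e) →
        (∀ x, φ.Sat M E (Matrix.vecCons x e) →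
          φ.Sat M E (Matrix.vecCons (M.add x M.one) e)) →
        ∀ x, φ.Sat M E (Matrix.vecCons x e) := by
  have h0 : ∀ e : Fin n → M.Num, (fun i => (Matrix.vecCons 0 Term.var i : Term n).val M e) =
      Matrix.vecCons M.zero e := by
    intro e
    funext i
    exact Fin.cases rfl (fun i => rfl) i
  have h1 : ∀ (x : M.Num) (e : Fin n → M.Num),
      (fun i => (Matrix.vecCons (Term.var 0 + 1) (fun i => Term.var i.succ) i :
        Term (n + 1)).val M (Matrix.vecCons x e)) = Matrix.vecCons (M.add x M.one) e := by
    intro x e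
    funext i
    exact Fin.cases rfl (fun i => rfl) i
  simp only [inductionAxiom, models_close, Sat, Formula.sat_subst, h0, h1, and_imp, id]

theorem models_deltaComprehensionAxiom (M : L2Structure.{u}) {m n : ℕ}
    (φ ψ : Formula m (n + 1)) :
    M.Models (deltaComprehensionAxiom φ ψ) ↔
      ∀ E : Fin m → Set M.Num, (∀ i, E i ∈ M.sets) → ∀ e : Fin n → M.Num,
        (∀ x, φ.Sat M E (Matrix.vecCons x e) ↔ ¬ ψ.Sat M E (Matrix.vecCons x e)) →
        ∃ X ∈ M.sets, ∀ x, x ∈ X ↔ φ.Sat M E (Matrix.vecCons x e) := by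
  simp only [deltaComprehensionAxiom, models_close, Sat, Formula.sat_subst, Formula.iff,
    ← iff_iff_implies_and_implies]
  rfl

/-! ### The ordered semiring of numbers -/

/-- `M` satisfies the axioms of the non-negative part of a discretely ordered ring. -/
class BasicModel (M : L2Structure.{u}) : Prop where
  models : ∀ ψ ∈ basicAxioms, M.Models ψ

section Arithmetic

variable (M : L2Structure.{u}) [BasicModel M]

theorem basicAxioms_semantics :
    (∀ a b c, M.add (M.add a b) c = M.add a (M.add b c)) ∧
    (∀ a b, M.add a b = M.add b a) ∧
    (∀ a, M.add a M.zero = a) ∧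
    (∀ a b c, M.mul (M.mul a b) c = M.mul a (M.mul b c)) ∧
    (∀ a b, M.mul a b = M.mul b a) ∧
    (∀ a, M.mul a M.one = a) ∧
    (∀ a, M.mul a M.zero = M.zero) ∧
    (∀ a b c, M.mul a (M.add b c) = M.add (M.mul a b) (M.mul a c)) ∧
    (∀ a, M.le a a) ∧
    (∀ a b, M.le a b ∧ M.le b a → a = b) ∧
    (∀ a b c, M.le a b ∧ M.le b c → M.le a c) ∧
    (∀ a b, M.le a b ∨ M.le b a) ∧
    (∀ a b c, M.le a b ∧ a ≠ b →
      M.le (M.add a c) (M.add b c) ∧ M.add a c ≠ M.add b c) ∧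
    (∀ a b c, (M.le M.zero c ∧ M.zero ≠ c) ∧ M.le a b ∧ a ≠ b →
      M.le (M.mul a c) (M.mul b c) ∧ M.mul a c ≠ M.mul b c) ∧
    (∀ a b, M.le a b → ∃ c, M.add a c = b) ∧
    (∀ a, M.le M.zero a) ∧
    (M.le M.zero M.one ∧ M.zero ≠ M.one) ∧
    (∀ a, M.le M.zero a ∧ M.zero ≠ a → M.le M.one a) := by
  have h := BasicModel.models (M := M)
  simp only [basicAxioms, Set.mem_insert_iff, Set.mem_singleton_iff, forall_eq_or_imp,
    forall_eq] at h
  obtain ⟨h1, h2, h3, h4, h5, h6, h7, h8, h9, h10, h11, h12, h13, h14, h15, h16, h17, h18⟩ := h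
  -- `closeNum` binds index `0` innermost, so the arguments of each axiom arrive in reverse order.
  exact ⟨fun a b c => h1 c b a, fun a b => h2 b a, h3, fun a b c => h4 c b a, fun a b => h5 b a,
    h6, h7, fun a b c => h8 c b a, h9, fun a b => h10 b a, fun a b c => h11 c b a,
    fun a b => h12 b a, fun a b c => h13 c b a, fun a b c => h14 c b a, fun a b => h15 b a,
    h16, h17, h18⟩

instance : CommSemiring M.Num where
  zero := M.zero
  one := M.one
  add := M.add
  mul := M.mul
  nsmul := @nsmulRec _ ⟨M.zero⟩ ⟨M.add⟩
  npow := @npowRec _ ⟨M.one⟩ ⟨M.mul⟩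
  add_assoc := (basicAxioms_semantics M).1
  add_comm := (basicAxioms_semantics M).2.1
  zero_add a := ((basicAxioms_semantics M).2.1 _ _).trans ((basicAxioms_semantics M).2.2.1 a)
  add_zero := (basicAxioms_semantics M).2.2.1
  mul_assoc := (basicAxioms_semantics M).2.2.2.1
  mul_comm := (basicAxioms_semantics M).2.2.2.2.1
  one_mul a := ((basicAxioms_semantics M).2.2.2.2.1 _ _).trans
    ((basicAxioms_semantics M).2.2.2.2.2.1 a)
  mul_one := (basicAxioms_semantics M).2.2.2.2.2.1
  zero_mul a := ((basicAxioms_semantics M).2.2.2.2.1 _ _).trans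
    ((basicAxioms_semantics M).2.2.2.2.2.2.1 a)
  mul_zero := (basicAxioms_semantics M).2.2.2.2.2.2.1
  left_distrib := (basicAxioms_semantics M).2.2.2.2.2.2.2.1
  right_distrib a b c := by
    obtain ⟨-, -, -, -, hc, -, -, hd, -⟩ := basicAxioms_semantics M
    exact (hc _ _).trans ((hd _ _ _).trans (congrArg₂ M.add (hc _ _) (hc _ _)))

noncomputable instance : LinearOrder M.Num where
  le := M.le
  -- This is literally the interpretation of `Formula.lt`, so strict inequalities in formulas unfold
  -- to `<`.
  lt a b := M.le a b ∧ ¬ a = b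
  le_refl := (basicAxioms_semantics M).2.2.2.2.2.2.2.2.1
  le_trans a b c h h' := (basicAxioms_semantics M).2.2.2.2.2.2.2.2.2.2.1 a b c ⟨h, h'⟩
  le_antisymm a b h h' := (basicAxioms_semantics M).2.2.2.2.2.2.2.2.2.1 a b ⟨h, h'⟩
  le_total := (basicAxioms_semantics M).2.2.2.2.2.2.2.2.2.2.2.1
  lt_iff_le_not_ge a b := by
    obtain ⟨-, -, -, -, -, -, -, -, hr, ha, -⟩ := basicAxioms_semantics M
    refine and_congr_right fun h => not_congr ⟨fun e => e ▸ hr a, fun h' => ha a b ⟨h, h'⟩⟩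
  toDecidableLE := Classical.decRel _

instance : IsStrictOrderedRing M.Num := by
  obtain ⟨-, -, -, -, -, -, -, -, -, -, -, -, ha, hm, -, -, h01, -⟩ := basicAxioms_semantics M
  have hle : ∀ a b : M.Num, a ≤ b → ∀ c, a + c ≤ b + c := by
    intro a b h c
    rcases h.eq_or_lt with rfl | h
    · exact le_rfl
    · exact (ha a b c h).1
  have hlt : ∀ a b c : M.Num, a < b → a + c < b + c := fun a b c h => ha a b c h
  have hmul : ∀ a b c : M.Num, 0 < c → a < b → a * c < b * c :=
    fun a b c h h' => hm a b c ⟨h, h'⟩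
  exact
    { add_le_add_left := hle
      le_of_add_le_add_left := fun a b c h => by
        by_contra h'
        have := hlt c b a (not_le.1 h')
        rw [add_comm c, add_comm b] at this
        exact absurd h (not_le.2 this)
      zero_le_one := h01.1
      exists_pair_ne := ⟨0, 1, h01.2⟩
      mul_lt_mul_of_pos_left := fun c hc a b h => by
        simpa only [mul_comm c] using hmul a b c hc h
      mul_lt_mul_of_pos_right := fun c hc a b h => hmul a b c hc h }

variable {M}

theorem num_zero_le (a : M.Num) : 0 ≤ a :=
  (basicAxioms_semantics M).2.2.2.2.2.2.2.2.2.2.2.2.2.2.2.1 a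

theorem exists_add_of_num_le {a b : M.Num} (h : a ≤ b) : ∃ c, a + c = b :=
  (basicAxioms_semantics M).2.2.2.2.2.2.2.2.2.2.2.2.2.2.1 a b h

theorem num_add_one_le {a b : M.Num} : a + 1 ≤ b ↔ a < b := by
  refine ⟨fun h => (lt_add_one a).trans_le h, fun h => ?_⟩
  obtain ⟨c, rfl⟩ := exists_add_of_num_le h.le
  have hc : (0 : M.Num) < c := by simpa using h
  have : (1 : M.Num) ≤ c :=
    (basicAxioms_semantics M).2.2.2.2.2.2.2.2.2.2.2.2.2.2.2.2.2 c hc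
  gcongr

theorem num_lt_add_one {a b : M.Num} : a < b + 1 ↔ a ≤ b := by
  rw [← not_le, num_add_one_le, not_lt]

theorem num_le_zero {a : M.Num} : a ≤ 0 ↔ a = 0 :=
  ⟨fun h => le_antisymm h (num_zero_le a), fun h => h.le⟩

theorem num_le_add_one {a b : M.Num} : a ≤ b + 1 ↔ a ≤ b ∨ a = b + 1 := by
  rw [le_iff_lt_or_eq, num_lt_add_one]

/-- The pairing `⟨a, b⟩ = (a + b)² + a`. -/
def numPair (a b : M.Num) : M.Num := (a + b) * (a + b) + a

theorem num_le_add_right (a b : M.Num) : a ≤ a + b := le_add_of_nonneg_right (num_zero_le b)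

theorem num_le_add_left (a b : M.Num) : a ≤ b + a := le_add_of_nonneg_left (num_zero_le b)

/-- A code bounds its components, so the quantifiers that decode an element of the colouring can be
bounded by that element. -/
theorem left_le_numPair (a b : M.Num) : a ≤ numPair a b := num_le_add_left _ _

theorem right_le_numPair (a b : M.Num) : b ≤ numPair a b := by
  rcases (num_zero_le b).eq_or_lt with h | h
  · rw [← h]; exact num_zero_le _
  · have h1 : 1 ≤ a + b := by
      rw [← zero_add 1, num_add_one_le]
      exact h.trans_le (num_le_add_left b a)
    calc b ≤ 1 * (a + b) := by rw [one_mul]; exact num_le_add_left b a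
      _ ≤ (a + b) * (a + b) := mul_le_mul_of_nonneg_right h1 (num_zero_le _)
      _ ≤ numPair a b := num_le_add_right _ _

/-- With `s = a + b`, the code lies in the interval `[s², (s + 1)²)`, and these intervals are
disjoint for different `s`. Hence a code determines first `s`, then `a`. -/
theorem numPair_lt_of_add_lt {a b a' b' : M.Num} (h : a + b < a' + b') :
    numPair a b < numPair a' b' := by
  have h1 : a + b + 1 ≤ a' + b' := num_add_one_le.2 h
  calc numPair a b = (a + b) * (a + b) + a := rfl
    _ < (a + b) * (a + b) + (a + 1 + b + (a + b)) := by
      refine add_lt_add_right ?_ _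
      refine (lt_add_one a).trans_le ?_
      rw [add_assoc (a + 1)]
      exact num_le_add_right _ _
    _ = (a + b + 1) * (a + b + 1) := by ring
    _ ≤ (a' + b') * (a' + b') :=
      mul_le_mul h1 h1 (num_zero_le _) (num_zero_le _)
    _ ≤ numPair a' b' := num_le_add_right _ _

theorem numPair_inj {a b a' b' : M.Num} : numPair a b = numPair a' b' ↔ a = a' ∧ b = b' := by
  refine ⟨fun h => ?_, fun h => by rw [h.1, h.2]⟩
  have hs : a + b = a' + b' := by
    rcases lt_trichotomy (a + b) (a' + b') with h' | h' | h'
    · exact absurd h (numPair_lt_of_add_lt h').ne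
    · exact h'
    · exact absurd h (numPair_lt_of_add_lt h').ne'
  have ha : a = a' := by
    rw [numPair, numPair, hs] at h
    exact add_left_cancel h
  subst ha
  exact ⟨rfl, add_left_cancel hs⟩

end Arithmetic

/-! ### Relations and functions definable by `Δ⁰₀` formulas and by terms -/

theorem Term.lift_subst {n n' : ℕ} (σ : Fin n → Term n') (t : Term n) :
    t.lift.subst (Matrix.vecCons (Term.var 0) fun i => (σ i).lift) = (t.subst σ).lift := by
  unfold Term.lift
  induction t with
  | var i => simp [Term.subst]
  | zero => rfl
  | one => rfl
  | add s t hs ht => simp only [Term.subst, hs, ht]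
  | mul s t hs ht => simp only [Term.subst, hs, ht]

/-- At a bounded quantifier the substituted bound must again avoid the bound variable;
`Term.lift_subst` exhibits it as a lifted term. -/
theorem Formula.IsDelta0.subst {m n : ℕ} {φ : Formula m n} (h : IsDelta0 φ) :
    ∀ {m' n' : ℕ} (ρ : Fin m → Fin m') (σ : Fin n → Term n'), IsDelta0 (φ.subst ρ σ) := by
  induction h with
  | eq s t => intros; exact .eq _ _
  | le s t => intros; exact .le _ _
  | mem t X => intros; exact .mem _ _
  | not _ h => intros; exact .not (h _ _)
  | and _ _ h h' => intros; exact .and (h _ _) (h' _ _)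
  | or _ _ h h' => intros; exact .or (h _ _) (h' _ _)
  | imp _ _ h h' => intros; exact .imp (h _ _) (h' _ _)
  | ball t _ h =>
    intro m' n' ρ σ
    simp only [Formula.subst, Term.lift_subst]
    exact .ball _ (h _ _)
  | bex t _ h =>
    intro m' n' ρ σ
    simp only [Formula.subst, Term.lift_subst]
    exact .bex _ (h _ _)

section Definability

variable {M : L2Structure.{u}} {m n : ℕ}

/-- `f` is the function defined by a term. -/
def TermFun (f : (Fin n → M.Num) → M.Num) : Prop := ∃ t : Term n, ∀ e, t.val M e = f e

/-- `R` is the relation defined by a `Δ⁰₀` formula with set parameters `E`. -/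
def Delta0Def (E : Fin m → Set M.Num) (R : (Fin n → M.Num) → Prop) : Prop :=
  ∃ φ : Formula m n, IsDelta0 φ ∧ ∀ e, φ.Sat M E e ↔ R e

theorem TermFun.var (i : Fin n) : TermFun fun e : Fin n → M.Num => e i := ⟨.var i, fun _ => rfl⟩

theorem TermFun.zero [BasicModel M] : TermFun fun _ : Fin n → M.Num => 0 := ⟨.zero, fun _ => rfl⟩

theorem TermFun.add [BasicModel M] {f g : (Fin n → M.Num) → M.Num} (hf : TermFun f) (hg : TermFun g) :
    TermFun fun e => f e + g e := by
  obtain ⟨s, hs⟩ := hf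
  obtain ⟨t, ht⟩ := hg
  exact ⟨.add s t, fun e => congrArg₂ M.add (hs e) (ht e)⟩

theorem TermFun.mul [BasicModel M] {f g : (Fin n → M.Num) → M.Num} (hf : TermFun f) (hg : TermFun g) :
    TermFun fun e => f e * g e := by
  obtain ⟨s, hs⟩ := hf
  obtain ⟨t, ht⟩ := hg
  exact ⟨.mul s t, fun e => congrArg₂ M.mul (hs e) (ht e)⟩

theorem TermFun.pair [BasicModel M] {f g : (Fin n → M.Num) → M.Num} (hf : TermFun f) (hg : TermFun g) :
    TermFun fun e => numPair (f e) (g e) :=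
  ((hf.add hg).mul (hf.add hg)).add hf

theorem TermFun.tail {f : (Fin n → M.Num) → M.Num} (hf : TermFun f) :
    TermFun fun e : Fin (n + 1) → M.Num => f fun i => e i.succ := by
  obtain ⟨t, ht⟩ := hf
  exact ⟨t.lift, fun e => by simp only [Term.lift, Term.val_subst, Term.val, ht]⟩

theorem TermFun.vecCons {f : (Fin n → M.Num) → M.Num} (hf : TermFun f) {k : ℕ}
    {h : (Fin n → M.Num) → Fin k → M.Num} (hh : ∀ i, TermFun fun e => h e i) (i : Fin (k + 1)) :
    TermFun fun e => (Matrix.vecCons (f e) (h e) : Fin (k + 1) → M.Num) i :=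
  Fin.cases hf hh i

variable {E : Fin m → Set M.Num}

/-! ### Closure properties of `Δ⁰₀` definability -/

namespace Delta0Def

theorem congr {R R' : (Fin n → M.Num) → Prop} (h : Delta0Def E R) (hR : ∀ e, R e ↔ R' e) :
    Delta0Def E R' := by
  obtain ⟨φ, hφ, h⟩ := h
  exact ⟨φ, hφ, fun e => (h e).trans (hR e)⟩

theorem eq {f g : (Fin n → M.Num) → M.Num} (hf : TermFun f) (hg : TermFun g) :
    Delta0Def E fun e => f e = g e := by
  obtain ⟨s, hs⟩ := hf
  obtain ⟨t, ht⟩ := hg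
  exact ⟨.eq s t, .eq s t, fun e => by simp only [Sat, hs, ht]⟩

theorem le [BasicModel M] {f g : (Fin n → M.Num) → M.Num} (hf : TermFun f) (hg : TermFun g) :
    Delta0Def E fun e => f e ≤ g e := by
  obtain ⟨s, hs⟩ := hf
  obtain ⟨t, ht⟩ := hg
  exact ⟨.le s t, .le s t, fun e => by simp only [Sat, hs, ht]; rfl⟩

theorem not {R : (Fin n → M.Num) → Prop} (h : Delta0Def E R) : Delta0Def E fun e => ¬ R e := by
  obtain ⟨φ, hφ, h⟩ := h
  exact ⟨.not φ, .not hφ, fun e => not_congr (h e)⟩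

theorem and {R R' : (Fin n → M.Num) → Prop} (h : Delta0Def E R) (h' : Delta0Def E R') :
    Delta0Def E fun e => R e ∧ R' e := by
  obtain ⟨φ, hφ, h⟩ := h
  obtain ⟨ψ, hψ, h'⟩ := h'
  exact ⟨.and φ ψ, .and hφ hψ, fun e => and_congr (h e) (h' e)⟩

theorem or {R R' : (Fin n → M.Num) → Prop} (h : Delta0Def E R) (h' : Delta0Def E R') :
    Delta0Def E fun e => R e ∨ R' e := by
  obtain ⟨φ, hφ, h⟩ := h
  obtain ⟨ψ, hψ, h'⟩ := h'
  exact ⟨.or φ ψ, .or hφ hψ, fun e => or_congr (h e) (h' e)⟩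

theorem imp {R R' : (Fin n → M.Num) → Prop} (h : Delta0Def E R) (h' : Delta0Def E R') :
    Delta0Def E fun e => R e → R' e := by
  obtain ⟨φ, hφ, h⟩ := h
  obtain ⟨ψ, hψ, h'⟩ := h'
  exact ⟨.imp φ ψ, .imp hφ hψ, fun e => imp_congr (h e) (h' e)⟩

theorem lt [BasicModel M] {f g : (Fin n → M.Num) → M.Num} (hf : TermFun f) (hg : TermFun g) :
    Delta0Def E fun e => f e < g e :=
  (le hg hf).not.congr fun _ => not_le

theorem bex [BasicModel M] {f : (Fin n → M.Num) → M.Num} (hf : TermFun f) {R : M.Num → (Fin n → M.Num) → Prop}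
    (h : Delta0Def E fun e : Fin (n + 1) → M.Num => R (e 0) fun i => e i.succ) :
    Delta0Def E fun e => ∃ x ≤ f e, R x e := by
  obtain ⟨t, ht⟩ := hf
  obtain ⟨φ, hφ, h⟩ := h
  refine ⟨_, .bex t hφ, fun e => exists_congr fun x => ?_⟩
  refine and_congr ?_ (h _)
  simp only [Sat, Term.val_lift, ht]
  rfl

theorem ball [BasicModel M] {f : (Fin n → M.Num) → M.Num} (hf : TermFun f)
    {R : M.Num → (Fin n → M.Num) → Prop}
    (h : Delta0Def E fun e : Fin (n + 1) → M.Num => R (e 0) fun i => e i.succ) :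
    Delta0Def E fun e => ∀ x ≤ f e, R x e := by
  obtain ⟨t, ht⟩ := hf
  obtain ⟨φ, hφ, h⟩ := h
  refine ⟨_, .ball t hφ, fun e => forall_congr' fun x => ?_⟩
  refine imp_congr ?_ (h _)
  simp only [Sat, Term.val_lift, ht]
  rfl

theorem comp {k : ℕ} {R : (Fin k → M.Num) → Prop} (h : Delta0Def E R)
    {g : (Fin n → M.Num) → Fin k → M.Num} (hg : ∀ i, TermFun fun e => g e i) :
    Delta0Def E fun e => R (g e) := by
  obtain ⟨φ, hφ, h⟩ := h
  choose σ hσ using hg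
  exact ⟨φ.subst id σ, hφ.subst _ _, fun e => by simp only [Formula.sat_subst, hσ, id, h]⟩

end Delta0Def

/-! ### Blocks of quantifiers -/

/-- `∃ x̄`, for a block of `k` variables. -/
def exB {N : Type*} : (k : ℕ) → ((Fin (n + k) → N) → Prop) → (Fin n → N) → Prop
  | 0, R => R
  | k + 1, R => exB k fun e => ∃ x, R (Matrix.vecCons x e)

/-- `∀ x̄`, for a block of `k` variables. -/
def allB {N : Type*} : (k : ℕ) → ((Fin (n + k) → N) → Prop) → (Fin n → N) → Prop
  | 0, R => R
  | k + 1, R => allB k fun e => ∀ x, R (Matrix.vecCons x e)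

/-- `∃ x̄ ≤ b`, for a block of `k` variables. -/
def bexB {N : Type*} [LE N] (b : N) :
    (k : ℕ) → ((Fin (n + k) → N) → Prop) → (Fin n → N) → Prop
  | 0, R => R
  | k + 1, R => bexB b k fun e => ∃ x ≤ b, R (Matrix.vecCons x e)

/-- `∀ x̄ ≤ b`, for a block of `k` variables. -/
def ballB {N : Type*} [LE N] (b : N) :
    (k : ℕ) → ((Fin (n + k) → N) → Prop) → (Fin n → N) → Prop
  | 0, R => R
  | k + 1, R => ballB b k fun e => ∀ x ≤ b, R (Matrix.vecCons x e)

theorem sat_exBlock (k : ℕ) (φ : Formula m (n + k)) (e : Fin n → M.Num) :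
    (exBlock k φ).Sat M E e ↔ exB k (φ.Sat M E) e := by
  induction k with
  | zero => rfl
  | succ k ih => exact ih (ex φ)

theorem sat_allBlock (k : ℕ) (φ : Formula m (n + k)) (e : Fin n → M.Num) :
    (allBlock k φ).Sat M E e ↔ allB k (φ.Sat M E) e := by
  induction k with
  | zero => rfl
  | succ k ih => exact ih (all φ)

/-! ### Bounding the variables of a quantifier block -/

section Blocks

variable {N : Type*} [LinearOrder N]

/-- Peeling off a variable changes the matrix as well as the block, so the induction needs
monotonicity in the bound and in the matrix at once. -/
theorem bexB_mono {b b' : N} (hb : b ≤ b') {k : ℕ} {R R' : (Fin (n + k) → N) → Prop}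
    (hR : ∀ e, R e → R' e) {e : Fin n → N} (h : bexB b k R e) : bexB b' k R' e := by
  induction k with
  | zero => exact hR e h
  | succ k ih =>
    refine ih ?_ h
    rintro e ⟨x, hx, hx'⟩
    exact ⟨x, hx.trans hb, hR _ hx'⟩

theorem ballB_mono {b b' : N} (hb : b' ≤ b) {k : ℕ} {R R' : (Fin (n + k) → N) → Prop}
    (hR : ∀ e, R e → R' e) {e : Fin n → N} (h : ballB b k R e) : ballB b' k R' e := by
  induction k with
  | zero => exact hR e h
  | succ k ih => exact ih (fun e h x hx => hR _ (h x (hx.trans hb))) h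

theorem exB_of_bexB {b : N} {k : ℕ} {R R' : (Fin (n + k) → N) → Prop}
    (hR : ∀ e, R e → R' e) {e : Fin n → N} (h : bexB b k R e) : exB k R' e := by
  induction k with
  | zero => exact hR e h
  | succ k ih =>
    refine ih ?_ h
    rintro e ⟨x, _, hx⟩
    exact ⟨x, hR _ hx⟩

theorem ballB_of_allB (b : N) {k : ℕ} {R R' : (Fin (n + k) → N) → Prop}
    (hR : ∀ e, R e → R' e) {e : Fin n → N} (h : allB k R e) : ballB b k R' e := by
  induction k with
  | zero => exact hR e h
  | succ k ih => exact ih (fun e h x _ => hR _ (h x)) h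

theorem bexB_exists {ι : Sort*} {b : N} {k : ℕ} {R : ι → (Fin (n + k) → N) → Prop}
    {e : Fin n → N} (h : bexB b k (fun e => ∃ i, R i e) e) : ∃ i, bexB b k (R i) e := by
  induction k with
  | zero => exact h
  | succ k ih =>
    refine ih (bexB_mono le_rfl ?_ h)
    rintro e ⟨x, hx, i, hi⟩
    exact ⟨i, x, hx, hi⟩

theorem ballB_forall {ι : Sort*} {b : N} {k : ℕ} {R : ι → (Fin (n + k) → N) → Prop}
    {e : Fin n → N} (h : ∀ i, ballB b k (R i) e) : ballB b k (fun e => ∀ i, R i e) e := by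
  induction k with
  | zero => exact h
  | succ k ih => exact ballB_mono (k := k) le_rfl (fun e h x hx i => h i x hx) (ih h)

/-- No collection is needed: existential quantifiers commute, so the last witness can be pulled out
of the block and the maximum of the two bounds taken. -/
theorem exists_bexB_of_exB [Nonempty N] {k : ℕ} {R : (Fin (n + k) → N) → Prop} {e : Fin n → N}
    (h : exB k R e) : ∃ b, bexB b k R e := by
  induction k with
  | zero => exact ‹Nonempty N›.elim fun b => ⟨b, h⟩
  | succ k ih =>
    obtain ⟨b, hb⟩ := ih h
    obtain ⟨x, hx⟩ := bexB_exists hb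
    exact ⟨max b x, bexB_mono (k := k) (le_max_left b x) (fun e he => ⟨x, le_max_right b x, he⟩) hx⟩

theorem allB_of_forall_ballB [Nonempty N] {k : ℕ} {R : (Fin (n + k) → N) → Prop} {e : Fin n → N}
    (h : ∀ b, ballB b k R e) : allB k R e := by
  induction k with
  | zero => exact ‹Nonempty N›.elim fun b => h b
  | succ k ih =>
    refine ih fun b => ballB_forall fun x => ?_
    exact ballB_mono (k := k) (le_max_left b x) (fun e he => he x (le_max_right b x)) (h (max b x))

end Blocks

/-- `R i j e` is uniformly `Δ⁰₀` in `i`, `j` and `e`. -/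
def UniformDelta0 (E : Fin m → Set M.Num) {p : ℕ}
    (R : M.Num → M.Num → (Fin p → M.Num) → Prop) : Prop :=
  ∀ (n : ℕ) (f g : (Fin n → M.Num) → M.Num) (h : (Fin n → M.Num) → Fin p → M.Num),
    TermFun f → TermFun g → (∀ i, TermFun fun e => h e i) →
    Delta0Def E fun e => R (f e) (g e) (h e)

/-- Since definability is required after every substitution of terms, the bound keeps its name while
new variables shift the de Bruijn indices; a block can then be treated one variable at a time. -/
theorem UniformDelta0.bex [BasicModel M] {p : ℕ} {R : M.Num → M.Num → (Fin (p + 1) → M.Num) → Prop}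
    (hR : UniformDelta0 E R) :
    UniformDelta0 E fun i j e => ∃ x ≤ i, R i j (Matrix.vecCons x e) := by
  intro n f g h hf hg hh
  exact Delta0Def.bex hf (hR _ _ _ _ hf.tail hg.tail
    (TermFun.vecCons (TermFun.var 0) fun i => (hh i).tail))

theorem UniformDelta0.ball [BasicModel M] {p : ℕ} {R : M.Num → M.Num → (Fin (p + 1) → M.Num) → Prop}
    (hR : UniformDelta0 E R) :
    UniformDelta0 E fun i j e => ∀ x ≤ j, R i j (Matrix.vecCons x e) := by
  intro n f g h hf hg hh
  exact Delta0Def.ball hg (hR _ _ _ _ hf.tail hg.tail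
    (TermFun.vecCons (TermFun.var 0) fun i => (hh i).tail))

theorem UniformDelta0.bexB [BasicModel M] {p k : ℕ} {R : M.Num → M.Num → (Fin (p + k) → M.Num) → Prop}
    (hR : UniformDelta0 E R) : UniformDelta0 E fun i j e => bexB i k (R i j) e := by
  induction k with
  | zero => exact hR
  | succ k ih => exact ih hR.bex

theorem UniformDelta0.ballB [BasicModel M] {p k : ℕ} {R : M.Num → M.Num → (Fin (p + k) → M.Num) → Prop}
    (hR : UniformDelta0 E R) : UniformDelta0 E fun i j e => ballB j k (R i j) e := by
  induction k with
  | zero => exact hR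
  | succ k ih => exact ih hR.ball

end Definability

/-! ### Consequences of `RCA₀` -/

/-- `M` is a model of `RCA₀`. -/
class RCA0Model (M : L2Structure.{u}) : Prop where
  models : ∀ ψ ∈ RCA0, M.Models ψ

section RCA0

variable {M : L2Structure.{u}} [RCA0Model M]

instance : BasicModel M := ⟨fun ψ hψ => RCA0Model.models ψ (Or.inl (Or.inl hψ))⟩

variable {m n : ℕ} {E : Fin m → Set M.Num}

theorem sigma1_induction (hE : ∀ i, E i ∈ M.sets) {R : M.Num → M.Num → (Fin n → M.Num) → Prop}
    (hR : UniformDelta0 E R) (e : Fin n → M.Num) (h0 : ∃ z, R z 0 e)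
    (h1 : ∀ x, (∃ z, R z x e) → ∃ z, R z (x + 1) e) (x : M.Num) : ∃ z, R z x e := by
  obtain ⟨φ, hφ, h⟩ := hR (n + 2) (fun w => w 0) (fun w => w 1) (fun w i => w i.succ.succ)
    (TermFun.var _) (TermFun.var _) fun i => TermFun.var _
  have hind : M.Models (inductionAxiom (ex φ)) :=
    RCA0Model.models _ (Or.inr ⟨m, n, ex φ, ⟨1, φ, hφ, rfl⟩, rfl⟩)
  have hS : ∀ x, (ex φ).Sat M E (Matrix.vecCons x e) ↔ ∃ z, R z x e :=
    fun x => exists_congr fun z => h _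
  have key := (models_inductionAxiom M _).1 hind E hE e
  simp only [hS] at key
  exact key h0 h1 x

theorem delta0_induction (hE : ∀ i, E i ∈ M.sets) {R : M.Num → (Fin n → M.Num) → Prop}
    (hR : UniformDelta0 E fun _ x e => R x e) (e : Fin n → M.Num) (h0 : R 0 e)
    (h1 : ∀ x, R x e → R (x + 1) e) (x : M.Num) : R x e := by
  -- The existential witness `z` is a dummy, as `R` does not depend on it.
  obtain ⟨-, h⟩ := sigma1_induction hE hR e ⟨0, h0⟩ (fun x ⟨z, h⟩ => ⟨z, h1 x h⟩) x
  exact h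

theorem delta0_comprehension (hE : ∀ i, E i ∈ M.sets) {R : M.Num → (Fin n → M.Num) → Prop}
    (hR : Delta0Def E fun w : Fin (n + 1) → M.Num => R (w 0) fun i => w i.succ)
    (e : Fin n → M.Num) : {x | R x e} ∈ M.sets := by
  obtain ⟨φ, hφ, h⟩ := hR
  have hcomp : M.Models (deltaComprehensionAxiom φ (.not φ)) :=
    RCA0Model.models _ (Or.inl (Or.inr ⟨m, n, φ, .not φ, ⟨0, φ, hφ, rfl⟩,
      ⟨0, .not φ, IsDelta0.not hφ, rfl⟩, rfl⟩))
  obtain ⟨X, hX, hX'⟩ := (models_deltaComprehensionAxiom M _ _).1 hcomp E hE e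
    fun x => not_not.symm
  have : {x | R x e} = X := Set.ext fun x => ((hX' x).trans (h _)).symm
  rwa [this]

/-- `Σ⁰₁` collection: if every `j` admits an `x ≤ i` with `R i j x`, and `R` is antitone in `j`,
then one `x ≤ i` works for all `j`. -/
theorem sigma1_collection (hE : ∀ i, E i ∈ M.sets)
    {R : M.Num → M.Num → (Fin (n + 1) → M.Num) → Prop} (hR : UniformDelta0 E R)
    (hanti : ∀ i j j' e, j' ≤ j → R i j e → R i j' e) (i : M.Num) (e : Fin n → M.Num)
    (h : ∀ j, ∃ x ≤ i, R i j (Matrix.vecCons x e)) :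
    ∃ x ≤ i, ∀ j, R i j (Matrix.vecCons x e) := by
  by_contra! hcon
  have hdef : UniformDelta0 E fun (z u : M.Num) (w : Fin (n + 1) → M.Num) =>
      ∀ x ≤ u, x ≤ w 0 → ¬ R (w 0) z (Matrix.vecCons x fun l => w l.succ) := by
    intro q f g w hf hg hw
    refine Delta0Def.ball hg (.imp (.le (.var 0) (hw 0).tail) (.not ?_))
    exact hR _ _ _ _ (hw 0).tail hf.tail (TermFun.vecCons (TermFun.var 0) fun l => (hw l.succ).tail)
  -- One stage `z` refutes all candidates `x ≤ u`: by antitonicity a refutation persists at later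
  -- stages, so the maximum of two stages serves for both. At `u = i` this contradicts `h z`.
  have hall : ∀ u, ∃ z, ∀ x ≤ u, x ≤ i → ¬ R i z (Matrix.vecCons x e) := by
    refine sigma1_induction hE hdef (Matrix.vecCons i e) ?_ ?_
    · obtain ⟨z, hz⟩ := hcon 0 (num_zero_le i)
      exact ⟨z, fun x hx _ => by rw [num_le_zero.1 hx]; exact hz⟩
    · rintro u ⟨z, hz⟩
      by_cases hu : u + 1 ≤ i
      · obtain ⟨z', hz'⟩ := hcon _ hu
        refine ⟨max z z', fun x hx hxi hRx => ?_⟩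
        rcases num_le_add_one.1 hx with hx | rfl
        · exact hz x hx hxi (hanti _ _ _ _ (le_max_left z z') hRx)
        · exact hz' (hanti _ _ _ _ (le_max_right z z') hRx)
      -- Beyond `i` there is no new candidate, so the old stage still works.
      · refine ⟨z, fun x hx hxi => ?_⟩
        rcases num_le_add_one.1 hx with hx | rfl
        · exact hz x hx hxi
        · exact absurd hxi hu
  obtain ⟨z, hz⟩ := hall i
  obtain ⟨x, hx, hx'⟩ := h z
  exact hz x hx hx hx'

/-- The innermost quantifier is first absorbed into the matrix, which stays uniformly `Δ⁰₀` and
antitone in `j`; the shorter block is handled by induction, and `sigma1_collection` then moves `∀ j`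
past the innermost quantifier. -/
theorem bexB_forall_of_forall_bexB (hE : ∀ i, E i ∈ M.sets) {k : ℕ}
    {R : M.Num → M.Num → (Fin (n + k) → M.Num) → Prop} (hR : UniformDelta0 E R)
    (hanti : ∀ i j j' e, j' ≤ j → R i j e → R i j' e) (i : M.Num) (e : Fin n → M.Num)
    (h : ∀ j, bexB i k (R i j) e) : bexB i k (fun e => ∀ j, R i j e) e := by
  induction k with
  | zero => exact h
  | succ k ih =>
    have := ih hR.bex (fun i j j' e hj ⟨x, hx, hx'⟩ => ⟨x, hx, hanti _ _ _ _ hj hx'⟩) h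
    exact bexB_mono (k := k) le_rfl (fun e he => sigma1_collection hE hR hanti i e he) this

/-- Having a greatest element up to `u` is itself a `Δ⁰₀` property of `u`, so `Δ⁰₀` induction
applies; `S 0 e` starts it. -/
theorem exists_greatest (hE : ∀ i, E i ∈ M.sets) {S : M.Num → (Fin n → M.Num) → Prop}
    (hS : UniformDelta0 E fun _ x e => S x e) (e : Fin n → M.Num) (h0 : S 0 e) (a : M.Num) :
    ∃ p ≤ a, S p e ∧ ∀ q ≤ a, S q e → q ≤ p := by
  refine delta0_induction hE (R := fun u e => ∃ p ≤ u, S p e ∧ ∀ q ≤ u, S q e → q ≤ p) ?_ e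
    ⟨0, le_rfl, h0, fun q hq _ => hq⟩ ?_ a
  · intro k f g h hf hg hh
    refine .bex hg (.and (hS _ _ _ _ hf.tail (.var 0) fun i => (hh i).tail) (.ball hg.tail ?_))
    exact .imp (hS _ _ _ _ hf.tail.tail (.var 0) fun i => (hh i).tail.tail)
      (.le (.var 0) (.var (Fin.succ 0)))
  · rintro u ⟨p, hp, hSp, hmax⟩
    by_cases hu : S (u + 1) e
    · exact ⟨u + 1, le_rfl, hu, fun q hq _ => hq⟩
    · refine ⟨p, hp.trans (num_le_add_right u 1), hSp, fun q hq hSq => ?_⟩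
      rcases num_le_add_one.1 hq with hq | rfl
      · exact hmax q hq hSq
      · exact absurd hSq hu

/-! ### Applying Ordered Ramsey's Theorem -/

/-- The order of the quantified variables is that of the de Bruijn closure, so the hypotheses match
the unfolded sentence definitionally. -/
theorem orderedRamsey_semantics (h : M.Models orderedRamsey) {P R C : Set M.Num}
    (hP : P ∈ M.sets) (hR : R ∈ M.sets) (hC : C ∈ M.sets) (hfin : ∃ b, ∀ x ∈ P, x < b)
    (hRP : ∀ r ∈ R, ∃ y x, x ∈ P ∧ y ∈ P ∧ r = numPair x y)
    (hrefl : ∀ x ∈ P, numPair x x ∈ R)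
    (hantisymm : ∀ y x, numPair x y ∈ R ∧ numPair y x ∈ R → x = y)
    (htrans : ∀ z y x, numPair x y ∈ R ∧ numPair y z ∈ R → numPair x z ∈ R)
    (hCP : ∀ c ∈ C, ∃ p j i, i < j ∧ p ∈ P ∧ c = numPair (numPair i j) p)
    (htotal : ∀ j i : M.Num, i < j → ∃ p, numPair (numPair i j) p ∈ C)
    (hfun : ∀ p' p j i, numPair (numPair i j) p ∈ C ∧ numPair (numPair i j) p' ∈ C → p = p')
    (hord : ∀ p' p k j i, i < j ∧ j < k ∧ numPair (numPair i j) p ∈ C ∧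
      numPair (numPair i k) p' ∈ C → numPair p' p ∈ R) :
    ∃ I : Set M.Num, (∀ x, ∃ y, x ≤ y ∧ y ∈ I) ∧
      ∀ p' p j' i' j i, i ∈ I ∧ j ∈ I ∧ i < j ∧ i' ∈ I ∧ j' ∈ I ∧ i' < j' ∧
        numPair (numPair i j) p ∈ C ∧ numPair (numPair i' j') p' ∈ C → p = p' := by
  obtain ⟨I, -, hI⟩ := h C hC R hR P hP
    ⟨hfin, ⟨hRP, hrefl, hantisymm, htrans⟩, ⟨hCP, htotal, hfun⟩, hord⟩
  exact ⟨I, hI⟩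

/-- For a `Δ⁰₀` predicate `S x i j` that is antitone in `j`, Ordered Ramsey's Theorem yields an
unbounded set such that the greatest `x ≤ a` with `S x i j` is the same for all `i < j` in it. -/
theorem exists_unbounded_greatest_eq (hORT : M.Models orderedRamsey) (hE : ∀ i, E i ∈ M.sets)
    {S : M.Num → M.Num → M.Num → (Fin n → M.Num) → Prop}
    (hS : ∀ (k : ℕ) (t f g : (Fin k → M.Num) → M.Num) (h : (Fin k → M.Num) → Fin n → M.Num),
      TermFun t → TermFun f → TermFun g → (∀ l, TermFun fun w => h w l) →
      Delta0Def E fun w => S (t w) (f w) (g w) (h w))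
    (e : Fin n → M.Num) (h0 : ∀ i j, S 0 i j e)
    (hanti : ∀ x i j j', j' ≤ j → S x i j e → S x i j' e) (a : M.Num) :
    ∃ p ≤ a, ∃ I : Set M.Num, (∀ x, ∃ y, x ≤ y ∧ y ∈ I) ∧
      ∀ i ∈ I, ∀ j ∈ I, i < j → S p i j e ∧ ∀ q ≤ a, S q i j e → q ≤ p := by
  let G : M.Num → M.Num → M.Num → Prop := fun i j p =>
    p ≤ a ∧ S p i j e ∧ ∀ q ≤ a, S q i j e → q ≤ p
  have hP : {x : M.Num | x ≤ a} ∈ M.sets :=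
    delta0_comprehension (R := fun x w => x ≤ w 0) hE (.le (.var 0) (.var (Fin.succ 0))) ![a]
  have hR : {r : M.Num | ∃ x ≤ a, ∃ y ≤ a, r = numPair x y ∧ x ≤ y} ∈ M.sets := by
    refine delta0_comprehension (R := fun r w => ∃ x ≤ w 0, ∃ y ≤ w 0, r = numPair x y ∧ x ≤ y)
      hE ?_ ![a]
    refine .bex (.var _) (.bex (.var _) (.and (.eq (.var _) (.pair (.var _) (.var _))) ?_))
    exact .le (.var _) (.var _)
  have hC : {c : M.Num | ∃ i ≤ c, ∃ j ≤ c, ∃ p ≤ c, c = numPair (numPair i j) p ∧ i < j ∧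
      G i j p} ∈ M.sets := by
    refine delta0_comprehension (R := fun c (w : Fin (n + 1) → M.Num) =>
      ∃ i ≤ c, ∃ j ≤ c, ∃ p ≤ c, c = numPair (numPair i j) p ∧ i < j ∧
        p ≤ w 0 ∧ S p i j (fun l => w l.succ) ∧
          ∀ q ≤ w 0, S q i j (fun l => w l.succ) → q ≤ p) hE ?_ (Matrix.vecCons a e)
    refine .bex (.var _) (.bex (.var _) (.bex (.var _) (.and
      (.eq (.var _) (.pair (.pair (.var _) (.var _)) (.var _)))
      (.and (.lt (.var _) (.var _)) (.and (.le (.var _) (.var _)) (.and ?_ ?_))))))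
    · exact hS _ _ _ _ _ (.var _) (.var _) (.var _) fun l => .var _
    · refine .ball (.var _) (.imp ?_ (.le (.var _) (.var _)))
      exact hS _ _ _ _ _ (.var _) (.var _) (.var _) fun l => .var _
  have hmemR : ∀ x y : M.Num, numPair x y ∈
      {r : M.Num | ∃ x ≤ a, ∃ y ≤ a, r = numPair x y ∧ x ≤ y} ↔ x ≤ y ∧ y ≤ a := by
    refine fun x y => ⟨?_, fun h => ⟨x, h.1.trans h.2, y, h.2, rfl, h.1⟩⟩
    rintro ⟨x', -, y', hy', hxy, hle⟩
    obtain ⟨rfl, rfl⟩ := numPair_inj.1 hxy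
    exact ⟨hle, hy'⟩
  have hmemC : ∀ i j p : M.Num, numPair (numPair i j) p ∈
      {c : M.Num | ∃ i ≤ c, ∃ j ≤ c, ∃ p ≤ c, c = numPair (numPair i j) p ∧ i < j ∧
        G i j p} ↔ i < j ∧ G i j p := by
    refine fun i j p => ⟨?_, fun h => ⟨i, (left_le_numPair i j).trans (left_le_numPair _ p),
      j, (right_le_numPair i j).trans (left_le_numPair _ p), p, right_le_numPair _ p, rfl, h⟩⟩
    rintro ⟨i', -, j', -, p', -, hc, h⟩
    obtain ⟨hij, rfl⟩ := numPair_inj.1 hc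
    obtain ⟨rfl, rfl⟩ := numPair_inj.1 hij
    exact h
  have hex : ∀ i j, ∃ p, G i j p := by
    intro i j
    have hdef : UniformDelta0 E fun (_ x : M.Num) (w : Fin (n + 2) → M.Num) =>
        S x (w 0) (w 1) fun l => w l.succ.succ :=
      fun k f g h _ hg hh => hS _ _ _ _ _ hg (hh _) (hh _) fun l => hh _
    exact exists_greatest hE hdef (Matrix.vecCons i (Matrix.vecCons j e)) (h0 i j) a
  obtain ⟨I, hI, hhom⟩ := orderedRamsey_semantics hORT hP hR hC
    ⟨a + 1, fun x hx => num_lt_add_one.2 hx⟩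
    (by
      rintro r ⟨x, hx, y, hy, hr, -⟩
      exact ⟨y, x, hx, hy, hr⟩)
    (fun x hx => (hmemR x x).2 ⟨le_rfl, hx⟩)
    (fun y x h => le_antisymm ((hmemR x y).1 h.1).1 ((hmemR y x).1 h.2).1)
    (fun z y x h => (hmemR x z).2
      ⟨((hmemR x y).1 h.1).1.trans ((hmemR y z).1 h.2).1, ((hmemR y z).1 h.2).2⟩)
    (by
      rintro c ⟨i, -, j, -, p, -, hc, hij, hG⟩
      exact ⟨p, j, i, hij, hG.1, hc⟩)
    (fun j i hij => (hex i j).imp fun p hp => (hmemC i j p).2 ⟨hij, hp⟩)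
    (by
      rintro p' p j i ⟨h, h'⟩
      obtain ⟨-, hp, hSp, hmax⟩ := (hmemC i j p).1 h
      obtain ⟨-, hp', hSp', hmax'⟩ := (hmemC i j p').1 h'
      exact le_antisymm (hmax' p hp hSp) (hmax p' hp' hSp'))
    -- The greatest `x` for `(i, k)` still satisfies `S` at `(i, j)`, because `S` is antitone in its
    -- last index; so it is at most the colour of `(i, j)`.
    (by
      rintro p' p k j i ⟨hij, hjk, h, h'⟩
      obtain ⟨-, hp, hSp, hmax⟩ := (hmemC i j p).1 h
      obtain ⟨-, hp', hSp', hmax'⟩ := (hmemC i k p').1 h'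
      exact (hmemR p' p).2 ⟨hmax p' hp' (hanti _ _ _ _ hjk.le hSp'), hp⟩)
  -- The common colour is read off from one actual pair `i₀ < j₀` in `I`.
  obtain ⟨i₀, -, hi₀⟩ := hI 0
  obtain ⟨j₀, hij₀, hj₀⟩ := hI (i₀ + 1)
  have hij₀ := num_add_one_le.1 hij₀
  obtain ⟨p, hp⟩ := hex i₀ j₀
  refine ⟨p, hp.1, I, hI, fun i hi j hj hij => ?_⟩
  obtain ⟨p', hp'⟩ := hex i j
  obtain rfl := hhom p' p j i j₀ i₀ ⟨hi₀, hj₀, hij₀, hi, hj, hij,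
    (hmemC _ _ _).2 ⟨hij₀, hp⟩, (hmemC _ _ _).2 ⟨hij, hp'⟩⟩
  exact hp'.2

theorem models_sigma2_induction (hORT : M.Models orderedRamsey) {φ : Formula m (n + 1)}
    (hφ : IsSigma 2 φ) : M.Models (inductionAxiom φ) := by
  obtain ⟨J, -, ⟨K, θ, hθ, rfl⟩, rfl⟩ := hφ
  have hθ : IsDelta0 θ := hθ
  rw [models_inductionAxiom]
  intro E hE e
  simp only [sat_exBlock]
  intro hzero hsucc a
  -- The `Δ⁰₀` approximation to `φ`: existential witnesses up to `i`, universal tests up to `j`.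
  let T : M.Num → M.Num → (Fin (n + 1) → M.Num) → Prop :=
    fun i j => bexB i J (ballB j K (θ.Sat M E))
  have hball : UniformDelta0 E fun _ j => ballB j K (θ.Sat M E) :=
    UniformDelta0.ballB fun _ _ _ _ _ _ hh => Delta0Def.comp ⟨θ, hθ, fun _ => Iff.rfl⟩ hh
  have hT : UniformDelta0 E T := hball.bexB
  have hT_of : ∀ x, exB J ((allBlock K θ).Sat M E) (Matrix.vecCons x e) →
      ∃ i₀, ∀ i, i₀ ≤ i → ∀ j, T i j (Matrix.vecCons x e) := by
    intro x hx
    obtain ⟨b, hb⟩ := exists_bexB_of_exB hx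
    exact ⟨b, fun i hi j => bexB_mono hi
      (fun v hv => ballB_of_allB j (fun _ h => h) ((sat_allBlock K θ v).1 hv)) hb⟩
  -- Collection is used here: witnesses below the fixed `i` that pass the tests up to each `j` are
  -- replaced by witnesses that pass all tests.
  have hof_T : ∀ i x, (∀ j, T i j (Matrix.vecCons x e)) →
      exB J ((allBlock K θ).Sat M E) (Matrix.vecCons x e) := by
    intro i x hx
    have := bexB_forall_of_forall_bexB hE hball
      (fun _ j j' v hj h => ballB_mono hj (fun _ h => h) h) i _ hx
    exact exB_of_bexB (fun v hv => (sat_allBlock K θ v).2 (allB_of_forall_ballB hv)) this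
  obtain ⟨p, hpa, I, hI, hp⟩ := exists_unbounded_greatest_eq hORT hE
    -- The disjunct `x = 0` guarantees that a greatest element exists; it is harmless because `φ(0)`
    -- is assumed.
    (S := fun x i j v => x = 0 ∨ T i j (Matrix.vecCons x v))
    (fun k t f g h ht hf hg hh => .or (.eq ht .zero) (hT _ _ _ _ hf hg (.vecCons ht hh)))
    e (fun _ _ => Or.inl rfl)
    (fun x i j j' hj h => h.imp_right fun h =>
      bexB_mono le_rfl (fun v hv => ballB_mono hj (fun _ h => h) hv) h) a
  have hφp : exB J ((allBlock K θ).Sat M E) (Matrix.vecCons p e) := by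
    by_cases hp0 : p = 0
    · rw [hp0]; exact hzero
    obtain ⟨i, -, hi⟩ := hI 0
    refine hof_T i p fun j => ?_
    -- `j'` has to exceed `i` for the pair to be coloured, and be at least `j` for antitonicity to
    -- bring `T` down to `j`.
    obtain ⟨j', hj', hj'I⟩ := hI (max j (i + 1))
    have hT' := ((hp i hi j' hj'I (num_add_one_le.1 ((le_max_right _ _).trans hj'))).1).resolve_left
      hp0
    exact bexB_mono le_rfl
      (fun v hv => ballB_mono ((le_max_left _ _).trans hj') (fun _ h => h) hv) hT'
  rcases hpa.eq_or_lt with rfl | hlt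
  · exact hφp
  -- If `p < a`, then `p + 1` is an admissible colour satisfying `T` for every pair in `I` beyond
  -- `i₀`, against the maximality of `p`.
  · obtain ⟨i₀, hi₀⟩ := hT_of (p + 1) (hsucc p hφp)
    obtain ⟨i, hii, hi⟩ := hI i₀
    obtain ⟨j, hij, hj⟩ := hI (i + 1)
    have := (hp i hi j hj (num_add_one_le.1 hij)).2 (p + 1) (num_add_one_le.2 hlt)
      (Or.inr (hi₀ i hii j))
    exact absurd (lt_add_one p) (not_lt.2 this)

end RCA0

end SecondOrderArithmetic

theorem mainTheorem5 (φ : SecondOrderArithmetic.Sentence)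
    (hφ : φ ∈ SecondOrderArithmetic.SigmaInduction 2) :
    SecondOrderArithmetic.Entails.{u}
      (SecondOrderArithmetic.RCA0 ∪ {SecondOrderArithmetic.orderedRamsey}) φ := by
  intro M hM
  obtain ⟨m, n, φ, hφ, rfl⟩ := hφ
  have : SecondOrderArithmetic.RCA0Model M := ⟨fun ψ hψ => hM ψ (Or.inl hψ)⟩
  exact SecondOrderArithmetic.models_sigma2_induction (hM _ (Or.inr rfl)) hφ
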